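/- Fix a number of arms $K$. Let $\mathcal{M}$ be the set of probability distributions on $\mathbb{R}$ supported in $[0,1]$, write $\mu(\nu)$ for the mean of $\nu\in\mathcal M$ and $\mathrm{D}$ for the Kullback–Leibler divergence, and for $\nu\in\mathcal{M}$, $m\in[0,1]$ put $$d_{\inf}(\nu,m,\mathcal{M})=\inf\{\mathrm{D}(\nu,\nu') : \nu'\in\mathcal{M},\ \mu(\nu')>m\}\in[0,\infty],\qquad \inf\emptyset=\infty .$$ A $K$-armed bandit is $\boldsymbol\nu=(\nu_1,\dots,\nu_K)\in\mathcal{M}^K$. The $n$-th pull of arm $i$ yields a reward $U^i_n$, where the $U^i_n$ ($1\le i\le K$, $n\ge 1$) are independent and $U^i_n\sim\nu_i$. A policy $\pi\in\Pi_T$ with horizon $T$ is a sequence of (measurable) maps $\pi_1,\dots,\pi_T$, where $\pi_t$ maps each history $(I_1,X_1,\dots,I_{t-1},X_{t-1})$ of arms played and rewards observed to the arm $I_t$ played at time $t$; the reward observed is then $X_t=U^{I_t}_{n^{I_t}_t}$, where $n^i_t$ is the number of times $s\le t$ with $I_s=i$. Let $$\mathcal{R}_T(\pi,\boldsymbol\nu)=\mathrm{E}\Big[\max_{1\le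 i\le K}\ \sum_{n=1}^{n^i_T}U^i_n\Big],\qquad \mathrm{Reg}_T(\pi,\boldsymbol\nu)=\sup_{\pi'\in\Pi_T}\mathcal{R}_T(\pi',\boldsymbol\nu)-\mathcal{R}_T(\pi,\boldsymbol\nu).$$ A sequence of policies $(\pi_T)_{T\in\mathbb{N}}$ with $\pi_T\in\Pi_T$ is consistent for $\mathcal{M}^K$ if for every $\boldsymbol\nu\in\mathcal{M}^K$ with a unique arm of highest mean and every $p>0$ one has $\lim_{T\to\infty}\mathrm{Reg}_T(\pi_T,\boldsymbol\nu)/T^p=0$. **Theorem.** Let $(\pi_T)_{T\in\mathbb{N}}$ be a consistent sequence of policies for $\mathcal{M}^K$. Then for every $\boldsymbol\nu\in\mathcal{M}^K$ with a unique arm $k^*$ of highest mean $\mu^*$, $$\liminf_{T\to\infty}\frac{\mathrm{Reg}_T(\pi_T,\boldsymbol\nu)}{\log T}\ \ge\ \sum_{i\ne k^*}\frac{\mu^*}{d_{\inf}(\nu_i,\mu^*,\mathcal{M})},$$ where a term with $d_{\inf}(\nu_i,\mu^*,\mathcal M)=\infty$ is $0$. -/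

import Mathlib

open MeasureTheory Filter Topology
open scoped ENNReal

noncomputable section

namespace MaxBandit

/-- The class `𝓜` of probability distributions on `ℝ` supported in `[0,1]`. -/
def unitDistributions : Set (ProbabilityMeasure ℝ) :=
  {ν | (ν : Measure ℝ) (Set.Icc (0 : ℝ) 1)ᶜ = 0}

/-- The class `𝓥 = 𝓜 ^ K` of `K`-armed bandits with `[0,1]`-supported rewards. -/
def unitBandits (K : ℕ) : Set (Fin K → ProbabilityMeasure ℝ) :=
  {ν | ∀ i, ν i ∈ unitDistributions}

/-- The mean of a distribution. -/
def mean (ν : ProbabilityMeasure ℝ) : ℝ := ∫ x, x ∂(ν : Measure ℝ)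

/-- `d_inf(ν, m, 𝓒)`: the infimum of the Kullback-Leibler divergences `D(ν, ν')` over the
`ν' ∈ 𝓒` with mean `> m`, with value `∞` if there is no such `ν'`. -/
def dInf (ν : ProbabilityMeasure ℝ) (m : ℝ) (C : Set (ProbabilityMeasure ℝ)) : ℝ≥0∞ :=
  ⨅ ν' ∈ C, ⨅ _ : m < mean ν', InformationTheory.klDiv (ν : Measure ℝ) (ν' : Measure ℝ)

/-- The arm `k` is the unique arm with the highest mean reward. -/
def IsUniqueOptimalArm {K : ℕ} (ν : Fin K → ProbabilityMeasure ℝ) (k : Fin K) : Prop :=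
  ∀ j, j ≠ k → mean (ν j) < mean (ν k)

/-- A history of `t` rounds: the arms played and the rewards observed. -/
abbrev History (K t : ℕ) : Type := Fin t → Fin K × ℝ

/-- A (deterministic, measurable) policy with horizon `T`; rounds are numbered `0, …, T - 1`, and
the arm played in round `t` is a function of the history of the `t` previous rounds. -/
structure Policy (K T : ℕ) where
  /-- the arm to be played in round `t` -/
  act : (t : Fin T) → History K t → Fin K
  measurable_act : ∀ t, Measurable (act t)

/-- The number of rounds of the history `h` in which arm `i` was played. -/
def pulls {K t : ℕ} (h : History K t) (i : Fin K) : ℕ :=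
  (Finset.univ.filter fun s : Fin t => (h s).1 = i).card

/-- A table of rewards: `u (i, n)` is the reward of the `(n + 1)`-st pull of arm `i`. -/
abbrev RewardTable (K : ℕ) : Type := Fin K × ℕ → ℝ

/-- Under the bandit `ν`, the entries of the reward table are independent, and all the entries of
arm `i` have distribution `ν i`. -/
def tableLaw {K : ℕ} (ν : Fin K → ProbabilityMeasure ℝ) : Measure (RewardTable K) :=
  Measure.infinitePi fun q : Fin K × ℕ => (ν q.1 : Measure ℝ)

/-- The history of the first `t` rounds when the policy `π` is run on the reward table `u`. -/
def Policy.history {K T : ℕ} (π : Policy K T) (u : RewardTable K) :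
    (t : ℕ) → t ≤ T → History K t
  | 0, _ => Fin.elim0
  | t + 1, ht =>
    let h : History K t := π.history u t (Nat.le_of_succ_le ht)
    let i : Fin K := π.act ⟨t, ht⟩ h
    Fin.snoc (α := fun _ => Fin K × ℝ) h (i, u (i, pulls h i))

/-- The cumulative reward obtained from arm `i` over the whole horizon. -/
def Policy.cumReward {K T : ℕ} (π : Policy K T) (u : RewardTable K) (i : Fin K) : ℝ :=
  ∑ n ∈ Finset.range (pulls (π.history u T le_rfl) i), u (i, n)

/-- The expectation of the largest cumulative reward among the arms. -/
def Policy.reward {K T : ℕ} (π : Policy K T) (ν : Fin K → ProbabilityMeasure ℝ) : ℝ :=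
  ∫ u, (⨆ i, π.cumReward u i) ∂(tableLaw ν)

/-- The regret of the policy `π` for the max objective. -/
def Policy.regret {K T : ℕ} (π : Policy K T) (ν : Fin K → ProbabilityMeasure ℝ) : ℝ :=
  (⨆ π' : Policy K T, π'.reward ν) - π.reward ν

/-- A sequence of policies, one for every horizon, is consistent for the class `V` if its regret is
`o(T ^ p)` for all `p > 0` on each bandit of `V` with a unique optimal arm. -/
def Consistent {K : ℕ} (π : (T : ℕ) → Policy K T) (V : Set (Fin K → ProbabilityMeasure ℝ)) :
    Prop :=
  ∀ ν ∈ V, (∃ k, IsUniqueOptimalArm ν k) → ∀ p : ℝ, 0 < p →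
    Tendsto (fun T : ℕ => (π T).regret ν / (T : ℝ) ^ p) atTop (𝓝 0)

end MaxBandit

end

/-! The argument is of Lai–Robbins type. Write `S_j` and `n_j` for the cumulative reward and the
number of pulls of arm `j`, and `δ` for the gap. The supremum in the regret is only compared with
constant play of `k`, which earns at least `T μ*`. When `k` wins, the maximum is `S_k`; as `E S_k =
μ* E n_k`, every pull of another arm costs the whole of `μ*` and not just a gap. When `k` fails,
because another arm is ahead or `k` has at most `N = o(T)` pulls, concentration bounds the maximum
by about `T (μ* - δ)`, a loss linear in `T`. `Policy.loss_le_regret` combines the two regimes.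

This bound is used twice. With consistency, it makes failure have probability `O(T^(p-1))` for each
`p > 0`, on every bandit whose unique optimal arm has positive mean. Replace `ν i` by some `m'` of
mean above `μ*`: arm `i` becomes optimal, so pulling it at most `N ≈ y log T` times is a failure
there. That event sees only `N` rewards of arm `i`, so returning to `ν` costs a factor of about `exp
(N D(ν i, m')) ≈ T^(y D)`. If `y D < 1`, the probability under `ν` tends to zero
(`Consistent.tendsto_measure_count_le`).

Under `ν` itself failure is also unlikely, so the expected number of pulls outside `k`, while `k`
wins, is asymptotically at least `∑ y i * log T`. Multiplying by `μ*` and letting each `y i`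
increase to `1 / d_inf` gives the bound. -/

namespace MaxBandit

/-! ### Infinite product measures: finite dependence and change of density. -/

section ProductMeasures

variable {ι : Type*}

/-- The event `E` is determined by the coordinates in `S`. -/
def DependsOnCoords (E : Set (ι → ℝ)) (S : Finset ι) : Prop :=
  ∀ u v : ι → ℝ, (∀ q ∈ S, u q = v q) → u ∈ E → v ∈ E

open Classical in
/-- Extension by zero of a finite family of reals. -/
noncomputable def extendZero (S : Finset ι) (y : S → ℝ) : ι → ℝ :=
  fun q => if h : q ∈ S then y ⟨q, h⟩ else 0

lemma measurable_extendZero (S : Finset ι) : Measurable (extendZero S) := by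
  refine measurable_pi_lambda _ fun q => ?_
  by_cases h : q ∈ S
  · simpa [extendZero, h] using measurable_pi_apply _
  · simp [extendZero, h]

lemma DependsOnCoords.eq_cylinder {E : Set (ι → ℝ)} {S : Finset ι} (h : DependsOnCoords E S) :
    E = cylinder S (extendZero S ⁻¹' E) := by
  ext u
  constructor
  · exact h _ _ fun q hq => by simp [extendZero, hq]
  · exact h _ _ fun q hq => by simp [extendZero, hq]

/-- The event is a cylinder over `S`, so factors outside `S` can be replaced freely. -/
lemma infinitePi_congr_of_dependsOnCoords {μ μ' : ι → Measure ℝ}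
    [∀ q, IsProbabilityMeasure (μ q)] [∀ q, IsProbabilityMeasure (μ' q)]
    {E : Set (ι → ℝ)} {S : Finset ι} (hE : MeasurableSet E) (h : DependsOnCoords E S)
    (hμ : ∀ q ∈ S, μ q = μ' q) : Measure.infinitePi μ E = Measure.infinitePi μ' E := by
  have hm := measurable_extendZero S hE
  rw [h.eq_cylinder, Measure.infinitePi_cylinder _ hm, Measure.infinitePi_cylinder _ hm]
  congr 2
  ext1 q
  exact hμ q q.2

/-- The indicator is a function of the coordinates in `S`, hence independent of a coordinate outside
`S`. Wald's identity rests on this. -/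
lemma integral_coord_mul_indicator {μ : ι → Measure ℝ} [∀ q, IsProbabilityMeasure (μ q)]
    {E : Set (ι → ℝ)} {S : Finset ι} (hE : MeasurableSet E) (h : DependsOnCoords E S)
    {q : ι} (hq : q ∉ S) :
    ∫ u, E.indicator 1 u * u q ∂(Measure.infinitePi μ)
      = (Measure.infinitePi μ).real E * ∫ x, x ∂(μ q) := by
  classical
  have hind : ProbabilityTheory.iIndepFun (fun (q : ι) (u : ι → ℝ) => u q)
      (Measure.infinitePi μ) :=
    ProbabilityTheory.iIndepFun_infinitePi (P := μ) (X := fun _ x => x) (fun _ => measurable_id)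
  have h1 := hind.indepFun_finset S {q} (by simpa using hq) (fun q => measurable_pi_apply q)
  have hm := measurable_extendZero S hE
  have hψ : Measurable fun y : ({q} : Finset ι) → ℝ => y ⟨q, Finset.mem_singleton_self q⟩ :=
    measurable_pi_apply (X := fun _ : ({q} : Finset ι) => ℝ) _
  have hφ : Measurable ((extendZero S ⁻¹' E).indicator (fun _ => (1 : ℝ))) :=
    measurable_const.indicator hm
  have h2 := h1.comp hφ hψ
  have h3 : ((extendZero S ⁻¹' E).indicator (fun _ => (1 : ℝ)) ∘
      fun (a : ι → ℝ) (i : S) => a i) = E.indicator 1 := by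
    ext u
    conv_rhs => rw [h.eq_cylinder]
    rfl
  rw [h3] at h2
  have h4 := h2.integral_fun_mul_eq_mul_integral
    ((measurable_one.indicator hE).aestronglyMeasurable)
    ((measurable_pi_apply q).aestronglyMeasurable)
  refine h4.trans ?_
  congr 1
  · exact integral_indicator_one hE
  · have := (measurePreserving_eval_infinitePi μ q).map_eq
    rw [← this, integral_map (measurable_pi_apply q).aemeasurable (by fun_prop)]
    rfl

/-- Changing finitely many factors of a product measure by densities changes the product measure by
the product of the densities. -/
lemma infinitePi_eq_withDensity {μ lam : ι → Measure ℝ}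
    [∀ q, IsProbabilityMeasure (μ q)] [∀ q, IsProbabilityMeasure (lam q)]
    {f : ι → ℝ → ℝ≥0∞} (hf : ∀ q, Measurable (f q)) (S : Finset ι)
    (hS : ∀ q ∈ S, μ q = (lam q).withDensity (f q)) (hS' : ∀ q, q ∉ S → μ q = lam q) :
    Measure.infinitePi μ
      = (Measure.infinitePi lam).withDensity fun u => ∏ q ∈ S, f q (u q) := by
  classical
  refine (Measure.eq_infinitePi μ fun s t ht => ?_).symm
  have hms : MeasurableSet (Set.pi (s : Set ι) t) :=
    MeasurableSet.pi s.countable_toSet fun q _ => ht q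
  rw [withDensity_apply _ hms, ← lintegral_indicator hms]
  -- One function per coordinate carries both the side of the box and the density, so independence
  -- factors the integral over the box.
  let g : ι → ℝ → ℝ≥0∞ := fun q x =>
    (if q ∈ s then (t q).indicator 1 x else 1) * (if q ∈ S then f q x else 1)
  have hg : ∀ q, Measurable (g q) := fun q => by
    refine Measurable.mul ?_ ?_
    · split_ifs
      · exact measurable_one.indicator (ht q)
      · exact measurable_const
    · split_ifs
      · exact hf q
      · exact measurable_const
  have hfun : (Set.pi (s : Set ι) t).indicator (fun u : ι → ℝ => ∏ q ∈ S, f q (u q))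
      = fun u => ∏ q ∈ s ∪ S, g q (u q) := by
    ext u
    simp only [g, Finset.prod_mul_distrib]
    have e1 : ∏ q ∈ s ∪ S, (if q ∈ S then f q (u q) else 1) = ∏ q ∈ S, f q (u q) := by
      rw [Finset.prod_ite_mem, Finset.inter_eq_right.2 Finset.subset_union_right]
    have e2 : ∏ q ∈ s ∪ S, (if q ∈ s then (t q).indicator (1 : ℝ → ℝ≥0∞) (u q) else 1)
        = ∏ q ∈ s, (t q).indicator 1 (u q) := by
      rw [Finset.prod_ite_mem, Finset.inter_eq_right.2 Finset.subset_union_left]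
    rw [e1, e2]
    by_cases hu : u ∈ Set.pi (s : Set ι) t
    · have e3 : ∏ q ∈ s, (t q).indicator (1 : ℝ → ℝ≥0∞) (u q) = 1 :=
        Finset.prod_eq_one fun q hq => by simp [hu q hq]
      rw [Set.indicator_of_mem hu, e3, one_mul]
    · rw [Set.indicator_of_notMem hu]
      simp only [Set.mem_pi, not_forall] at hu
      obtain ⟨q, hq, hqu⟩ := hu
      rw [Finset.prod_eq_zero hq (by simp [hqu]), zero_mul]
  rw [hfun]
  have hind : ProbabilityTheory.iIndepFun (fun (q : ι) (u : ι → ℝ) => g q (u q))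
      (Measure.infinitePi lam) :=
    ProbabilityTheory.iIndepFun_infinitePi (P := lam) (X := g) hg
  rw [ProbabilityTheory.lintegral_prod_eq_prod_lintegral_of_indepFun (s ∪ S)
    (fun (q : ι) (u : ι → ℝ) => g q (u q)) hind
    (fun q => (hg q).comp (measurable_pi_apply q))]
  have hone : ∀ q, ∫⁻ u, g q (u q) ∂(Measure.infinitePi lam)
      = if q ∈ s then μ q (t q) else 1 := fun q => by
    have e : ∫⁻ u, g q (u q) ∂(Measure.infinitePi lam) = ∫⁻ x, g q x ∂(lam q) := by
      have := (measurePreserving_eval_infinitePi lam q).lintegral_comp (hg q)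
      exact this
    rw [e]
    have hw : μ q = (lam q).withDensity (fun x => if q ∈ S then f q x else 1) := by
      by_cases hq : q ∈ S
      · simpa [hq] using hS q hq
      · simp only [hq, if_false]
        rw [hS' q hq]
        exact (withDensity_one).symm
    by_cases hs : q ∈ s
    · rw [if_pos hs, hw, withDensity_apply _ (ht q), ← lintegral_indicator (ht q)]
      refine lintegral_congr fun x => ?_
      by_cases hx : x ∈ t q <;> simp [g, hs, hx]
    · rw [if_neg hs]
      have h1 : (μ q) Set.univ = 1 := measure_univ
      rw [hw, withDensity_apply _ MeasurableSet.univ, Measure.restrict_univ] at h1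
      simpa [g, hs] using h1
  simp only [hone]
  rw [Finset.prod_ite_mem, Finset.inter_eq_right.2 Finset.subset_union_left]

end ProductMeasures

/-! ### Histories: counting, measurability, locality. -/

section Histories

variable {K T : ℕ}

lemma pulls_snoc {t : ℕ} (h : History K t) (x : Fin K × ℝ) (j : Fin K) :
    pulls (Fin.snoc (α := fun _ => Fin K × ℝ) h x : History K (t + 1)) j
      = pulls h j + if x.1 = j then 1 else 0 := by
  simp only [pulls, Finset.card_filter]
  rw [Fin.sum_univ_castSucc]
  simp

lemma pulls_le {t : ℕ} (h : History K t) (j : Fin K) : pulls h j ≤ t := by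
  simpa [pulls] using Finset.card_filter_le (Finset.univ : Finset (Fin t)) (fun s => (h s).1 = j)

lemma sum_pulls {t : ℕ} (h : History K t) : ∑ j, pulls h j = t := by
  simp only [pulls]
  rw [← Finset.card_eq_sum_card_fiberwise (f := fun s => (h s).1) (t := Finset.univ)
    (fun _ _ => by simp)]
  simp

lemma measurable_pulls {t : ℕ} (j : Fin K) : Measurable fun h : History K t => pulls h j := by
  simp only [pulls, Finset.card_filter]
  refine Finset.measurable_sum _ fun s _ => ?_
  refine Measurable.ite ?_ measurable_const measurable_const
  exact (measurable_fst.comp (measurable_pi_apply s)) (measurableSet_singleton j)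

lemma Policy.pulls_history_succ (π : Policy K T) (u : RewardTable K) (t : ℕ) (ht : t + 1 ≤ T)
    (j : Fin K) : pulls (π.history u (t + 1) ht) j
      = pulls (π.history u t (Nat.le_of_succ_le ht)) j
        + if π.act ⟨t, ht⟩ (π.history u t (Nat.le_of_succ_le ht)) = j then 1 else 0 := by
  rw [Policy.history, pulls_snoc]

lemma Policy.measurable_history (π : Policy K T) (t : ℕ) (ht : t ≤ T) :
    Measurable fun u : RewardTable K => π.history u t ht := by
  induction t with
  | zero => exact measurable_const' fun _ _ => by simp [Policy.history]
  | succ t ih =>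
    have h1 := ih (Nat.le_of_succ_le ht)
    have h2 : Measurable fun u => π.act ⟨t, ht⟩ (π.history u t (Nat.le_of_succ_le ht)) :=
      (π.measurable_act ⟨t, ht⟩).comp h1
    have h3 : Measurable fun u : RewardTable K =>
        pulls (π.history u t (Nat.le_of_succ_le ht))
          (π.act ⟨t, ht⟩ (π.history u t (Nat.le_of_succ_le ht))) := by
      have : Measurable fun p : History K t × Fin K => pulls p.1 p.2 :=
        measurable_from_prod_countable_left fun j => measurable_pulls j
      exact this.comp (h1.prodMk h2)
    -- The entry that is read depends on the history; evaluation at a random index is jointly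
    -- measurable because there are only countably many indices.
    have h4 : Measurable fun p : RewardTable K × (Fin K × ℕ) => p.1 p.2 :=
      measurable_from_prod_countable_left fun q => measurable_pi_apply q
    have h5 := h4.comp (measurable_id.prodMk (h2.prodMk h3))
    refine measurable_pi_lambda _ fun s => ?_
    refine Fin.lastCases ?_ (fun s => ?_) s
    · simpa [Policy.history] using h2.prodMk h5
    · have h6 := (measurable_pi_apply s).comp h1
      simpa [Policy.history, Function.comp_def] using h6

/-- If arm `i` is pulled at most `N` times, only the first `N` of its rewards matter. -/
lemma Policy.history_congr (π : Policy K T) {u v : RewardTable K} {i : Fin K} {N : ℕ}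
    (huv : ∀ q : Fin K × ℕ, q.2 < T → (q.1 = i → q.2 < N) → u q = v q) (t : ℕ) (ht : t ≤ T)
    (hN : pulls (π.history u t ht) i ≤ N) : π.history u t ht = π.history v t ht := by
  induction t with
  | zero => exact funext fun s => s.elim0
  | succ t ih =>
    rw [π.pulls_history_succ] at hN
    have h1 := ih (Nat.le_of_succ_le ht) (by omega)
    simp only [Policy.history]
    rw [← h1]
    congr 2
    -- A pull of `i` reads the index equal to the number of earlier pulls, and brings the count to
    -- at most `N`; so the index is below `N`.
    refine huv _ ((pulls_le _ _).trans_lt ht) fun hi => ?_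
    simp only at hi ⊢
    rw [if_pos hi] at hN
    rw [hi]
    omega

end Histories

/-! ### Reward tables, Wald's identity and the constant policy. -/

variable {K T : ℕ} {ν : Fin K → ProbabilityMeasure ℝ}

instance tableLaw.instIsProbabilityMeasure (ν : Fin K → ProbabilityMeasure ℝ) :
    IsProbabilityMeasure (tableLaw ν) := by
  unfold tableLaw
  infer_instance

lemma measurePreserving_eval_tableLaw (ν : Fin K → ProbabilityMeasure ℝ) (q : Fin K × ℕ) :
    MeasurePreserving (fun u : RewardTable K => u q) (tableLaw ν) (ν q.1 : Measure ℝ) :=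
  measurePreserving_eval_infinitePi (fun q : Fin K × ℕ => (ν q.1 : Measure ℝ)) q

lemma ae_mem_Icc_of_mem_unitDistributions {m : ProbabilityMeasure ℝ}
    (hm : m ∈ unitDistributions) : ∀ᵐ x ∂(m : Measure ℝ), x ∈ Set.Icc (0 : ℝ) 1 := hm

lemma mean_mem_Icc {m : ProbabilityMeasure ℝ} (hm : m ∈ unitDistributions) :
    mean m ∈ Set.Icc (0 : ℝ) 1 := by
  have h := ae_mem_Icc_of_mem_unitDistributions hm
  constructor
  · exact integral_nonneg_of_ae (h.mono fun x hx => hx.1)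
  · have h2 : mean m ≤ ∫ _, (1 : ℝ) ∂(m : Measure ℝ) :=
      integral_mono_ae (Integrable.of_mem_Icc 0 1 measurable_id.aemeasurable h)
        (integrable_const 1) (h.mono fun x hx => hx.2)
    simpa using h2

lemma ae_table_mem_Icc (hν : ν ∈ unitBandits K) :
    ∀ᵐ u ∂(tableLaw ν), ∀ q, u q ∈ Set.Icc (0 : ℝ) 1 :=
  ae_all_iff.2 fun q => (measurePreserving_eval_tableLaw ν q).quasiMeasurePreserving.ae
    (ae_mem_Icc_of_mem_unitDistributions (hν q.1))

lemma integral_table_coord (ν : Fin K → ProbabilityMeasure ℝ) (q : Fin K × ℕ) :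
    ∫ u, u q ∂(tableLaw ν) = mean (ν q.1) := by
  rw [mean, ← (measurePreserving_eval_tableLaw ν q).map_eq,
    integral_map (measurable_pi_apply q).aemeasurable (by fun_prop)]

lemma integrable_table_coord (hν : ν ∈ unitBandits K) (q : Fin K × ℕ) :
    Integrable (fun u => u q) (tableLaw ν) :=
  Integrable.of_mem_Icc 0 1 (measurable_pi_apply q).aemeasurable
    ((ae_table_mem_Icc hν).mono fun _ hu => hu q)

/-- The number of pulls of arm `i` over the whole horizon. -/
noncomputable def Policy.count (π : Policy K T) (u : RewardTable K) (i : Fin K) : ℕ :=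
  pulls (π.history u T le_rfl) i

/-- The largest cumulative reward. -/
noncomputable def Policy.maxReward (π : Policy K T) (u : RewardTable K) : ℝ :=
  ⨆ i, π.cumReward u i

namespace Policy

variable (π : Policy K T)

lemma count_le (u : RewardTable K) (i : Fin K) : π.count u i ≤ T := pulls_le _ _

lemma sum_count (u : RewardTable K) : ∑ i, π.count u i = T := sum_pulls _

lemma measurable_count (i : Fin K) : Measurable fun u => π.count u i :=
  (measurable_pulls i).comp (π.measurable_history T le_rfl)

lemma measurableSet_count_le (i : Fin K) (N : ℕ) : MeasurableSet {u | π.count u i ≤ N} :=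
  measurableSet_le (π.measurable_count i) measurable_const

/-- The entries of the reward table that can be observed while arm `i` is pulled at most `N`
times. -/
def observable (K T : ℕ) (i : Fin K) (N : ℕ) : Finset (Fin K × ℕ) :=
  (Finset.univ ×ˢ Finset.range T).filter fun q => q.1 = i → q.2 < N

lemma dependsOnCoords_count_le (i : Fin K) (N : ℕ) :
    DependsOnCoords {u | π.count u i ≤ N} (observable K T i N) := by
  intro u v huv hu
  have := π.history_congr (u := u) (v := v) (i := i) (N := N)
    (fun q h1 h2 => huv q (by simpa [observable] using ⟨h1, h2⟩)) T le_rfl hu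
  simpa [count, ← this] using hu

lemma cumReward_eq_sum_indicator (u : RewardTable K) (i : Fin K) :
    π.cumReward u i
      = ∑ n ∈ Finset.range T, ({v | π.count v i ≤ n}ᶜ : Set (RewardTable K)).indicator 1 u
          * u (i, n) := by
  have h : Finset.range (π.count u i)
      = (Finset.range T).filter fun n => n < π.count u i := by
    ext n
    have := π.count_le u i
    simp only [Finset.mem_range, Finset.mem_filter]
    omega
  change ∑ n ∈ Finset.range (π.count u i), u (i, n) = _
  rw [h, Finset.sum_filter]
  refine Finset.sum_congr rfl fun n _ => ?_
  by_cases hn : n < π.count u i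
  · simp [hn]
  · simp [hn]

lemma count_eq_sum_indicator (u : RewardTable K) (i : Fin K) :
    (π.count u i : ℝ)
      = ∑ n ∈ Finset.range T, ({v | π.count v i ≤ n}ᶜ : Set (RewardTable K)).indicator 1 u := by
  have h : Finset.range (π.count u i)
      = (Finset.range T).filter fun n => n < π.count u i := by
    ext n
    have := π.count_le u i
    simp only [Finset.mem_range, Finset.mem_filter]
    omega
  rw [← Finset.card_range (π.count u i), h, Finset.card_filter]
  push_cast
  refine Finset.sum_congr rfl fun n _ => ?_
  by_cases hn : n < π.count u i
  · simp [hn]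
  · simp [hn]

lemma measurable_cumReward (i : Fin K) : Measurable fun u => π.cumReward u i := by
  simp only [π.cumReward_eq_sum_indicator]
  refine Finset.measurable_sum _ fun n _ => Measurable.mul ?_ (measurable_pi_apply _)
  exact measurable_one.indicator (π.measurableSet_count_le i n).compl

lemma measurable_maxReward : Measurable π.maxReward :=
  Measurable.iSup fun i => π.measurable_cumReward i

lemma cumReward_nonneg {u : RewardTable K} (hu : ∀ q, u q ∈ Set.Icc (0 : ℝ) 1) (i : Fin K) :
    0 ≤ π.cumReward u i :=
  Finset.sum_nonneg fun _ _ => (hu _).1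

lemma cumReward_le_count {u : RewardTable K} (hu : ∀ q, u q ∈ Set.Icc (0 : ℝ) 1) (i : Fin K) :
    π.cumReward u i ≤ π.count u i := by
  have := Finset.sum_le_card_nsmul (Finset.range (π.count u i)) (fun n => u (i, n)) 1
    fun n _ => (hu _).2
  exact this.trans_eq (by simp)

lemma cumReward_le_maxReward (u : RewardTable K) (i : Fin K) :
    π.cumReward u i ≤ π.maxReward u :=
  le_ciSup (f := fun i => π.cumReward u i) (Set.finite_range _).bddAbove i

lemma maxReward_mem_Icc {u : RewardTable K} (hu : ∀ q, u q ∈ Set.Icc (0 : ℝ) 1) :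
    π.maxReward u ∈ Set.Icc (0 : ℝ) T := by
  constructor
  · exact Real.iSup_nonneg fun i => π.cumReward_nonneg hu i
  · refine Real.iSup_le (fun i => (π.cumReward_le_count hu i).trans ?_) (Nat.cast_nonneg _)
    exact_mod_cast π.count_le u i

lemma integrable_cumReward (hν : ν ∈ unitBandits K) (i : Fin K) :
    Integrable (fun u => π.cumReward u i) (tableLaw ν) :=
  Integrable.of_mem_Icc 0 T (π.measurable_cumReward i).aemeasurable
    ((ae_table_mem_Icc hν).mono fun u hu => ⟨π.cumReward_nonneg hu i,
      (π.cumReward_le_count hu i).trans (by exact_mod_cast π.count_le u i)⟩)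

lemma integrable_maxReward (hν : ν ∈ unitBandits K) :
    Integrable π.maxReward (tableLaw ν) :=
  Integrable.of_mem_Icc 0 T π.measurable_maxReward.aemeasurable
    ((ae_table_mem_Icc hν).mono fun _ hu => π.maxReward_mem_Icc hu)

lemma integrable_count (i : Fin K) :
    Integrable (fun u => (π.count u i : ℝ)) (tableLaw ν) :=
  Integrable.of_mem_Icc 0 T (measurable_from_top.comp (π.measurable_count i)).aemeasurable
    (.of_forall fun u => ⟨Nat.cast_nonneg _, by exact_mod_cast π.count_le u i⟩)

/-- Wald's identity. -/
lemma integral_cumReward (hν : ν ∈ unitBandits K) (i : Fin K) :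
    ∫ u, π.cumReward u i ∂(tableLaw ν) = mean (ν i) * ∫ u, (π.count u i : ℝ) ∂(tableLaw ν) := by
  have hmeas := fun n => π.measurableSet_count_le i n
  -- Whether the count exceeds `n` is decided without seeing entry `(i, n)`, since indices start at
  -- zero.
  have hterm : ∀ n, ∫ u, ({v | π.count v i ≤ n} : Set (RewardTable K)).indicator 1 u * u (i, n)
      ∂(tableLaw ν) = (tableLaw ν).real {v | π.count v i ≤ n} * mean (ν i) := fun n =>
    integral_coord_mul_indicator (μ := fun q : Fin K × ℕ => (ν q.1 : Measure ℝ)) (hmeas n)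
      (π.dependsOnCoords_count_le i n) (q := (i, n)) (by simp [observable])
  have hint : ∀ n, Integrable
      (fun u => ({v | π.count v i ≤ n} : Set (RewardTable K)).indicator 1 u * u (i, n))
      (tableLaw ν) := fun n => by
    refine (integrable_table_coord hν (i, n)).bdd_mul (c := 1)
      (measurable_one.indicator (hmeas n)).aestronglyMeasurable (.of_forall fun u => ?_)
    by_cases h : u ∈ {v | π.count v i ≤ n} <;>
      simp only [Set.indicator, h, if_true, if_false] <;> simp
  have hcompl : ∀ n, (fun u : RewardTable K =>
      ({v | π.count v i ≤ n}ᶜ : Set (RewardTable K)).indicator 1 u * u (i, n))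
      = fun u => u (i, n)
        - ({v | π.count v i ≤ n} : Set (RewardTable K)).indicator 1 u * u (i, n) := fun n => by
    ext u
    by_cases h : π.count u i ≤ n <;> simp [h]
  simp only [π.cumReward_eq_sum_indicator, π.count_eq_sum_indicator]
  rw [integral_finsetSum, integral_finsetSum, Finset.mul_sum]
  · refine Finset.sum_congr rfl fun n _ => ?_
    rw [hcompl n, integral_sub (integrable_table_coord hν _) (hint n), hterm n,
      integral_table_coord, integral_indicator_one (hmeas n).compl,
      probReal_compl_eq_one_sub (hmeas n)]
    ring
  · intro n _
    exact (integrable_const (1 : ℝ)).indicator (hmeas n).compl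
  · intro n _
    rw [hcompl n]
    exact (integrable_table_coord hν _).sub (hint n)

/-- The policy that always plays arm `k`. -/
def constant (T : ℕ) (k : Fin K) : Policy K T where
  act _ _ := k
  measurable_act _ := measurable_const

lemma count_constant (k : Fin K) (u : RewardTable K) : (constant T k).count u k = T := by
  have : ∀ t (ht : t ≤ T), pulls ((constant T k).history u t ht) k = t := by
    intro t
    induction t with
    | zero => intro _; simp [pulls]
    | succ t ih =>
      intro ht
      rw [pulls_history_succ, ih (Nat.le_of_succ_le ht)]
      simp [constant]
  exact this T le_rfl

lemma reward_eq (ν : Fin K → ProbabilityMeasure ℝ) :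
    π.reward ν = ∫ u, π.maxReward u ∂(tableLaw ν) := rfl

lemma reward_le (hν : ν ∈ unitBandits K) : π.reward ν ≤ T := by
  have h : π.reward ν ≤ ∫ _, (T : ℝ) ∂(tableLaw ν) :=
    integral_mono_ae (π.integrable_maxReward hν) (integrable_const _)
      ((ae_table_mem_Icc hν).mono fun _ hu => (π.maxReward_mem_Icc hu).2)
  simpa using h

/-- A real `⨆` is a genuine supremum only for a bounded family. -/
lemma bddAbove_reward (hν : ν ∈ unitBandits K) :
    BddAbove (Set.range fun π' : Policy K T => π'.reward ν) :=
  ⟨T, by rintro _ ⟨π', rfl⟩; exact π'.reward_le hν⟩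

lemma regret_nonneg (hν : ν ∈ unitBandits K) : 0 ≤ π.regret ν :=
  sub_nonneg.2 (le_ciSup (bddAbove_reward hν) π)

lemma mul_mean_sub_reward_le_regret (hν : ν ∈ unitBandits K) (k : Fin K) :
    T * mean (ν k) - π.reward ν ≤ π.regret ν := by
  refine sub_le_sub_right (le_trans ?_ (le_ciSup (bddAbove_reward hν) (constant T k))) _
  have h := integral_mono ((constant T k).integrable_cumReward hν k)
    ((constant T k).integrable_maxReward hν)
    fun u => (constant T k).cumReward_le_maxReward u k
  rw [integral_cumReward _ hν] at h
  simpa [count_constant, mul_comm, ← reward_eq] using h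

end Policy

/-! ### Uniform concentration of the empirical sums. -/

/-- Some empirical sum of at most `T` rewards of an arm is further than `δ * T` from its
expectation. -/
def deviationEvent (ν : Fin K → ProbabilityMeasure ℝ) (δ : ℝ) (T : ℕ) : Set (RewardTable K) :=
  ⋃ j : Fin K, ⋃ n ∈ Finset.range (T + 1),
    {u | δ * T < |∑ m ∈ Finset.range n, u (j, m) - n * mean (ν j)|}

lemma measurableSet_deviationEvent (ν : Fin K → ProbabilityMeasure ℝ) (δ : ℝ) (T : ℕ) :
    MeasurableSet (deviationEvent ν δ T) := by
  refine MeasurableSet.iUnion fun j => Finset.measurableSet_biUnion _ fun n _ => ?_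
  refine measurableSet_lt measurable_const ?_
  fun_prop

lemma abs_sum_sub_le_of_notMem_deviationEvent {δ : ℝ} {u : RewardTable K}
    (hu : u ∉ deviationEvent ν δ T) (j : Fin K) {n : ℕ} (hn : n ≤ T) :
    |∑ m ∈ Finset.range n, u (j, m) - n * mean (ν j)| ≤ δ * T := by
  by_contra! h
  exact hu (Set.mem_iUnion.2 ⟨j, Set.mem_biUnion (Finset.mem_coe.2 (Finset.mem_range.2 (by omega)))
    h⟩)

/-- Hoeffding's inequality on both sides, for a deterministic `n`. Random numbers of pulls are
covered later by a union over all `n ≤ T`. -/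
lemma measure_abs_sum_sub_gt_le (hν : ν ∈ unitBandits K) {δ : ℝ} (hδ : 0 < δ) (j : Fin K)
    {n : ℕ} (hn : n ≤ T) :
    (tableLaw ν).real {u | δ * T < |∑ m ∈ Finset.range n, u (j, m) - n * mean (ν j)|}
      ≤ 2 * Real.exp (-2 * δ ^ 2) ^ T := by
  -- For `n = 0` the exponent would be a division by zero, with the useless bound `1`; the event is
  -- empty instead.
  rcases Nat.eq_zero_or_pos n with rfl | hn0
  · have : {u : RewardTable K | δ * T < |∑ m ∈ Finset.range 0, u (j, m) - (0 : ℕ) * mean (ν j)|}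
        = ∅ := by
      ext u
      simp only [Finset.range_zero, Finset.sum_empty, Nat.cast_zero, zero_mul, sub_zero, abs_zero,
        Set.mem_ofPred_eq, Set.mem_empty_iff_false, iff_false, not_lt]
      positivity
    rw [this]
    simp only [measureReal_empty]
    positivity
  have hsub : ∀ m, ProbabilityTheory.HasSubgaussianMGF
      (fun u : RewardTable K => u (j, m) - mean (ν j)) ((‖(1 : ℝ) - 0‖₊ / 2) ^ 2)
      (tableLaw ν) := fun m => by
    have := ProbabilityTheory.hasSubgaussianMGF_of_mem_Icc (μ := tableLaw ν)
      (X := fun u => u (j, m)) (a := 0) (b := 1) (measurable_pi_apply _).aemeasurable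
      ((ae_table_mem_Icc hν).mono fun _ hu => hu _)
    rwa [integral_table_coord] at this
  have hinj : Function.Injective fun m : ℕ => (j, m) := fun a b h => (Prod.mk.inj h).2
  have hind : ProbabilityTheory.iIndepFun
      (fun (m : ℕ) (u : RewardTable K) => u (j, m) - mean (ν j)) (tableLaw ν) :=
    (ProbabilityTheory.iIndepFun_infinitePi (P := fun q : Fin K × ℕ => (ν q.1 : Measure ℝ))
      (X := fun _ x => x - mean (ν j)) (fun _ => by fun_prop)).precomp hinj
  have hindn : ProbabilityTheory.iIndepFun
      (fun (m : ℕ) (u : RewardTable K) => -(u (j, m) - mean (ν j))) (tableLaw ν) :=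
    (ProbabilityTheory.iIndepFun_infinitePi (P := fun q : Fin K × ℕ => (ν q.1 : Measure ℝ))
      (X := fun _ x => -(x - mean (ν j))) (fun _ => by fun_prop)).precomp hinj
  have hε : 0 ≤ δ * T := by positivity
  have h1 := ProbabilityTheory.HasSubgaussianMGF.measure_sum_range_ge_le_of_iIndepFun hind
    (n := n) (fun m _ => hsub m) hε
  have h2 := ProbabilityTheory.HasSubgaussianMGF.measure_sum_range_ge_le_of_iIndepFun hindn
    (n := n) (fun m _ => (hsub m).neg) hε
  have hbound : Real.exp (-(δ * T) ^ 2 / (2 * n * (((‖(1 : ℝ) - 0‖₊ / 2) ^ 2 : NNReal) : ℝ)))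
      ≤ Real.exp (-2 * δ ^ 2) ^ T := by
    rw [← Real.exp_nat_mul, Real.exp_le_exp]
    have hnpos : (0 : ℝ) < n := by exact_mod_cast hn0
    have hnT : (n : ℝ) ≤ T := by exact_mod_cast hn
    have e : 2 * (n : ℝ) * (((‖(1 : ℝ) - 0‖₊ / 2) ^ 2 : NNReal) : ℝ) = n / 2 := by
      push_cast
      simp
      ring
    -- The exponent is `-2 δ² T² / n`, at most `-2 δ² T` because `n ≤ T`.
    rw [e, div_le_iff₀ (by positivity)]
    nlinarith [mul_nonneg (mul_nonneg (sq_nonneg δ) (Nat.cast_nonneg (α := ℝ) T))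
      (sub_nonneg.2 hnT)]
  have hcover : {u : RewardTable K | δ * T < |∑ m ∈ Finset.range n, u (j, m) - n * mean (ν j)|}
      ⊆ {u | δ * T ≤ ∑ m ∈ Finset.range n, (u (j, m) - mean (ν j))}
        ∪ {u | δ * T ≤ ∑ m ∈ Finset.range n, -(u (j, m) - mean (ν j))} := by
    intro u hu
    simp only [Set.mem_union, Set.mem_ofPred_eq, Finset.sum_neg_distrib, Finset.sum_sub_distrib,
      Finset.sum_const, Finset.card_range, nsmul_eq_mul] at hu ⊢
    rcases lt_abs.1 hu with h | h
    · exact Or.inl h.le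
    · exact Or.inr h.le
  calc _ ≤ _ := measureReal_mono hcover
    _ ≤ _ := measureReal_union_le _ _
    _ ≤ _ := by linarith [h1.trans hbound, h2.trans hbound]

lemma tendsto_mul_measure_deviationEvent (hν : ν ∈ unitBandits K) {δ : ℝ} (hδ : 0 < δ) :
    Tendsto (fun T : ℕ => T * (tableLaw ν).real (deviationEvent ν δ T)) atTop (𝓝 0) := by
  set r := Real.exp (-2 * δ ^ 2) with hr
  have hr1 : |r| < 1 := by
    rw [abs_of_pos (Real.exp_pos _), Real.exp_lt_one_iff]
    nlinarith [sq_nonneg δ, pow_pos hδ 2]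
  have hlim : Tendsto (fun T : ℕ => 2 * K * ((T : ℝ) ^ 2 * r ^ T + (T : ℝ) ^ 1 * r ^ T)) atTop
      (𝓝 0) := by
    simpa using ((tendsto_pow_const_mul_const_pow_of_abs_lt_one 2 hr1).add
      (tendsto_pow_const_mul_const_pow_of_abs_lt_one 1 hr1)).const_mul (2 * K : ℝ)
  refine squeeze_zero (fun T => by positivity) (fun T => ?_) hlim
  have h : (tableLaw ν).real (deviationEvent ν δ T) ≤ K * ((T + 1) * (2 * r ^ T)) := by
    calc _ ≤ ∑ j : Fin K, (tableLaw ν).real (⋃ n ∈ Finset.range (T + 1),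
          {u | δ * T < |∑ m ∈ Finset.range n, u (j, m) - n * mean (ν j)|}) :=
          measureReal_iUnion_fintype_le _
      _ ≤ ∑ j : Fin K, ∑ n ∈ Finset.range (T + 1), (tableLaw ν).real
          {u | δ * T < |∑ m ∈ Finset.range n, u (j, m) - n * mean (ν j)|} :=
          Finset.sum_le_sum fun j _ => measureReal_biUnion_finset_le _ _
      _ ≤ ∑ j : Fin K, ∑ n ∈ Finset.range (T + 1), 2 * r ^ T :=
          Finset.sum_le_sum fun j _ => Finset.sum_le_sum fun n hn =>
            measure_abs_sum_sub_gt_le hν hδ j (by simpa [Nat.lt_succ_iff] using hn)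
      _ = _ := by simp
  calc _ ≤ (T : ℝ) * (K * ((T + 1) * (2 * r ^ T))) := by gcongr
    _ = _ := by ring

/-! ### Failure of the optimal arm and the regret decomposition. -/

/-- Some other arm has a larger cumulative reward than arm `k`, or arm `k` is pulled at most `N`
times. -/
def Policy.failureEvent (π : Policy K T) (k : Fin K) (N : ℕ) : Set (RewardTable K) :=
  {u | π.cumReward u k < π.maxReward u} ∪ {u | π.count u k ≤ N}

namespace Policy

variable (π : Policy K T)

lemma measurableSet_failureEvent (k : Fin K) (N : ℕ) :
    MeasurableSet (π.failureEvent k N) :=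
  (measurableSet_lt (π.measurable_cumReward k) π.measurable_maxReward).union
    (π.measurableSet_count_le k N)

/-- Another arm collects at most its mean per pull, up to `δ T / 8`. Arm `k` can attain the maximum
only if it has at most `N` pulls, hence reward at most `N ≤ δ T / 8`; then `δ ≤ μ*` makes the bound
cover it. -/
lemma maxReward_le_of_notMem_deviationEvent (hν : ν ∈ unitBandits K) {k : Fin K} {δ : ℝ}
    (hδ : 0 < δ) (hgap : ∀ j, j ≠ k → mean (ν j) ≤ mean (ν k) - δ) (hδμ : δ ≤ mean (ν k)) {N : ℕ}
    (hN : (N : ℝ) ≤ δ / 8 * T) {u : RewardTable K} (hu : ∀ q, u q ∈ Set.Icc (0 : ℝ) 1)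
    (hA : u ∈ π.failureEvent k N) (hG : u ∉ deviationEvent ν (δ / 8) T) :
    π.maxReward u ≤ T * (mean (ν k) - δ) + δ / 8 * T := by
  have hT : (0 : ℝ) ≤ T := Nat.cast_nonneg T
  have hother : ∀ j, j ≠ k → π.cumReward u j ≤ T * (mean (ν k) - δ) + δ / 8 * T := fun j hj => by
    have h1 := abs_sum_sub_le_of_notMem_deviationEvent hG j (π.count_le u j)
    have h2 : π.cumReward u j - π.count u j * mean (ν j) ≤ δ / 8 * T := (abs_le.1 h1).2
    have h3 : (π.count u j : ℝ) ≤ T := by exact_mod_cast π.count_le u j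
    have h4 : (π.count u j : ℝ) * mean (ν j) ≤ T * (mean (ν k) - δ) :=
      mul_le_mul h3 (hgap j hj) (mean_mem_Icc (hν j)).1 hT
    linarith
  have hbound : 0 ≤ T * (mean (ν k) - δ) + δ / 8 * T :=
    add_nonneg (mul_nonneg hT (sub_nonneg.2 hδμ)) (by positivity)
  rcases hA with hlt | hle
  · by_contra! hcon
    have : Nonempty (Fin K) := ⟨k⟩
    obtain ⟨j, hj⟩ := exists_eq_ciSup_of_finite (f := fun i => π.cumReward u i)
    change π.cumReward u j = π.maxReward u at hj
    by_cases hjk : j = k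
    · rw [hjk] at hj
      exact absurd hj (ne_of_lt hlt)
    · linarith [hother j hjk]
  · refine Real.iSup_le (fun j => ?_) hbound
    by_cases hjk : j = k
    · have h1 := π.cumReward_le_count hu j
      have h2 : (π.count u j : ℝ) ≤ N := by rw [hjk]; exact_mod_cast hle
      have h3 := mul_nonneg hT (sub_nonneg.2 hδμ)
      linarith
    · exact hother j hjk

/-- The term `μ* n_k - S_k` has mean zero and is kept so that the comparison holds table by table.
If `k` does not fail, the first two terms sum exactly to `T μ* - S_k`. On failure without deviation,
the left side is at most `5 δ T / 8` and the right side at least `7 δ T / 8`. On a deviation, `3 T`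
outweighs everything. -/
lemma loss_pointwise (hν : ν ∈ unitBandits K) {k : Fin K} {δ : ℝ}
    (hδ : 0 < δ) (hgap : ∀ j, j ≠ k → mean (ν j) ≤ mean (ν k) - δ) (hδμ : δ ≤ mean (ν k)) {N : ℕ}
    (hN : (N : ℝ) ≤ δ / 8 * T) {u : RewardTable K} (hu : ∀ q, u q ∈ Set.Icc (0 : ℝ) 1) :
    mean (ν k) * (π.failureEvent k N)ᶜ.indicator (fun u => (T - π.count u k : ℝ)) u
        + (mean (ν k) * π.count u k - π.cumReward u k)
        + δ / 2 * T * (π.failureEvent k N).indicator 1 u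
        - 3 * T * (deviationEvent ν (δ / 8) T).indicator 1 u
      ≤ T * mean (ν k) - π.maxReward u := by
  have hμ := mean_mem_Icc (hν k)
  have hT : (0 : ℝ) ≤ T := Nat.cast_nonneg T
  by_cases hA : u ∈ π.failureEvent k N
  · have hc : (π.count u k : ℝ) ≤ T := by exact_mod_cast π.count_le u k
    have hS := π.cumReward_nonneg hu k
    rw [Set.indicator_of_notMem (by simpa using hA), Set.indicator_of_mem hA]
    by_cases hG : u ∈ deviationEvent ν (δ / 8) T
    · rw [Set.indicator_of_mem hG]
      have hM := (π.maxReward_mem_Icc hu).2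
      have h1 : mean (ν k) * π.count u k ≤ 1 * T :=
        mul_le_mul hμ.2 hc (Nat.cast_nonneg _) zero_le_one
      have h2 : δ * T ≤ 1 * T := mul_le_mul_of_nonneg_right (hδμ.trans hμ.2) hT
      have h3 : 0 ≤ T * mean (ν k) := mul_nonneg hT hμ.1
      simp only [Pi.one_apply]
      linarith
    · rw [Set.indicator_of_notMem hG]
      have hM := π.maxReward_le_of_notMem_deviationEvent hν hδ hgap hδμ hN hu hA hG
      have h1 := abs_sum_sub_le_of_notMem_deviationEvent hG k (π.count_le u k)
      have h2 : -(δ / 8 * T) ≤ π.cumReward u k - π.count u k * mean (ν k) := (abs_le.1 h1).1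
      have h3 : 0 ≤ δ * T := by positivity
      simp only [Pi.one_apply]
      linarith
  · have hM : π.maxReward u ≤ π.cumReward u k := by
      by_contra! h
      exact hA (Or.inl h)
    rw [Set.indicator_of_mem (by simpa using hA), Set.indicator_of_notMem hA]
    have h3 : 0 ≤ 3 * (T : ℝ) * (deviationEvent ν (δ / 8) T).indicator 1 u :=
      mul_nonneg (by positivity) (Set.indicator_nonneg (fun _ _ => zero_le_one) _)
    linarith

/-- The regret is at least the reward forgone by the pulls of suboptimal arms on the event that the
optimal arm wins, plus a loss linear in the horizon on the complement. -/
lemma loss_le_regret (hν : ν ∈ unitBandits K) {k : Fin K} {δ : ℝ}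
    (hδ : 0 < δ) (hgap : ∀ j, j ≠ k → mean (ν j) ≤ mean (ν k) - δ) (hδμ : δ ≤ mean (ν k)) {N : ℕ}
    (hN : (N : ℝ) ≤ δ / 8 * T) :
    mean (ν k) * ∫ u, (π.failureEvent k N)ᶜ.indicator (fun u => (T - π.count u k : ℝ)) u
          ∂(tableLaw ν)
        + δ / 2 * T * (tableLaw ν).real (π.failureEvent k N)
        - 3 * T * (tableLaw ν).real (deviationEvent ν (δ / 8) T)
      ≤ π.regret ν := by
  have hA := π.measurableSet_failureEvent k N
  have hG := measurableSet_deviationEvent ν (δ / 8) T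
  have i1 : Integrable (fun u => mean (ν k)
      * (π.failureEvent k N)ᶜ.indicator (fun u => (T - π.count u k : ℝ)) u) (tableLaw ν) :=
    (((integrable_const (T : ℝ)).sub (π.integrable_count k)).indicator hA.compl).const_mul _
  have i2 : Integrable (fun u => mean (ν k) * π.count u k - π.cumReward u k) (tableLaw ν) :=
    ((π.integrable_count k).const_mul _).sub (π.integrable_cumReward hν k)
  have i3 : Integrable (fun u : RewardTable K =>
      δ / 2 * T * (π.failureEvent k N).indicator 1 u) (tableLaw ν) :=
    ((integrable_const (1 : ℝ)).indicator hA).const_mul _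
  have i4 : Integrable (fun u : RewardTable K =>
      3 * T * (deviationEvent ν (δ / 8) T).indicator (1 : RewardTable K → ℝ) u) (tableLaw ν) :=
    ((integrable_const (1 : ℝ)).indicator hG).const_mul _
  have h := integral_mono_ae (((i1.add i2).add i3).sub i4)
    ((integrable_const ((T : ℝ) * mean (ν k))).sub (π.integrable_maxReward hν))
    ((ae_table_mem_Icc hν).mono fun u hu => π.loss_pointwise hν hδ hgap hδμ hN hu)
  -- Wald's identity cancels the integral of `μ* n_k - S_k`.
  rw [integral_sub' ((i1.add i2).add i3) i4, integral_add' (i1.add i2) i3, integral_add' i1 i2,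
    integral_sub ((π.integrable_count k).const_mul _) (π.integrable_cumReward hν k),
    π.integral_cumReward hν, integral_sub' (integrable_const _) (π.integrable_maxReward hν),
    integral_const_mul, integral_const_mul, integral_const_mul, integral_const_mul,
    integral_indicator_one hA, integral_indicator_one hG, ← reward_eq] at h
  have h2 := π.mul_mean_sub_reward_le_regret hν k
  simp only [integral_const, probReal_univ, one_smul] at h
  linarith

lemma measure_failureEvent_le (hν : ν ∈ unitBandits K) {k : Fin K} {δ : ℝ}
    (hδ : 0 < δ) (hgap : ∀ j, j ≠ k → mean (ν j) ≤ mean (ν k) - δ) (hδμ : δ ≤ mean (ν k)) {N : ℕ}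
    (hN : (N : ℝ) ≤ δ / 8 * T) :
    δ / 2 * T * (tableLaw ν).real (π.failureEvent k N)
      ≤ π.regret ν + 3 * T * (tableLaw ν).real (deviationEvent ν (δ / 8) T) := by
  have h := π.loss_le_regret hν hδ hgap hδμ hN
  have h2 : 0 ≤ mean (ν k) * ∫ u, (π.failureEvent k N)ᶜ.indicator
      (fun u => (T - π.count u k : ℝ)) u ∂(tableLaw ν) := by
    refine mul_nonneg (mean_mem_Icc (hν k)).1 (integral_nonneg fun u =>
      Set.indicator_nonneg (fun u _ => sub_nonneg.2 (Nat.cast_le.2 (π.count_le u k))) u)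
  linarith

end Policy

/-- A unique optimal arm with positive mean has a positive gap that is at most its mean. -/
lemma IsUniqueOptimalArm.exists_gap {k : Fin K} (hk : IsUniqueOptimalArm ν k)
    (hpos : 0 < mean (ν k)) :
    ∃ δ : ℝ, 0 < δ ∧ (∀ j, j ≠ k → mean (ν j) ≤ mean (ν k) - δ) ∧ δ ≤ mean (ν k) := by
  -- The value `μ*` at `k` enforces `δ ≤ μ*` and leaves a positive minimum even when `k` is the only
  -- arm.
  let g : Fin K → ℝ := fun j => if j = k then mean (ν k) else mean (ν k) - mean (ν j)
  have : Nonempty (Fin K) := ⟨k⟩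
  obtain ⟨j₀, hj₀⟩ := Finite.exists_min g
  refine ⟨g j₀, ?_, fun j hj => ?_, ?_⟩
  · by_cases h : j₀ = k
    · simpa [g, h] using hpos
    · simpa [g, h] using hk j₀ h
  · have := hj₀ j
    simp only [g, hj, if_false] at this ⊢
    linarith
  · have := hj₀ k
    simpa [g] using this

/-- For a consistent sequence of policies, the probability of the failure event decays faster than
any power of the horizon of exponent larger than `-1`. -/
lemma Consistent.eventually_measure_failureEvent_le {π : (T : ℕ) → Policy K T}
    (hπ : Consistent π (unitBandits K)) (hν : ν ∈ unitBandits K) {k : Fin K}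
    (hk : IsUniqueOptimalArm ν k) (hpos : 0 < mean (ν k)) {N : ℕ → ℕ}
    (hN : Tendsto (fun T => (N T : ℝ) / T) atTop (𝓝 0)) {p : ℝ} (hp : 0 < p) :
    ∃ C : ℝ, ∀ᶠ T : ℕ in atTop,
      (tableLaw ν).real ((π T).failureEvent k (N T)) ≤ C * (T : ℝ) ^ (p - 1) := by
  obtain ⟨δ, hδ, hgap, hδμ⟩ := hk.exists_gap hpos
  -- The regret and the deviation term are each eventually at most `T^p`; this is `2 T^p` divided by
  -- `δ T / 2`.
  refine ⟨4 / δ, ?_⟩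
  have h1 := (hπ ν hν ⟨k, hk⟩ p hp).eventually_le_const (zero_lt_one)
  have h2 := (tendsto_mul_measure_deviationEvent hν (δ := δ / 8) (by positivity)).eventually_le_const
    (show (0 : ℝ) < 1 / 3 by norm_num)
  have h3 := hN.eventually_le_const (show 0 < δ / 8 by positivity)
  filter_upwards [h1, h2, h3, eventually_ge_atTop 1] with T h1 h2 h3 hT
  have hT' : (1 : ℝ) ≤ T := by exact_mod_cast hT
  have hT0 : (0 : ℝ) < T := by linarith
  have hTp : 1 ≤ (T : ℝ) ^ p := Real.one_le_rpow hT' hp.le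
  rw [div_le_one (by positivity)] at h1
  rw [div_le_iff₀ hT0] at h3
  have h := (π T).measure_failureEvent_le hν hδ hgap hδμ h3
  rw [Real.rpow_sub_one hT0.ne']
  have e : 4 / δ * ((T : ℝ) ^ p / T) = (2 * (T : ℝ) ^ p) / (δ / 2 * T) := by
    field_simp
    norm_num
  rw [e, le_div_iff₀ (by positivity)]
  linarith

/-! ### Change of measure and log-likelihood ratios. -/

/-- The log-likelihood ratio between `ν i` and `m'` of the first `N` rewards of arm `i`. -/
noncomputable def tableLlr (ν : Fin K → ProbabilityMeasure ℝ) (i : Fin K)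
    (m' : ProbabilityMeasure ℝ) (N : ℕ) (u : RewardTable K) : ℝ :=
  ∑ n ∈ Finset.range N, llr (ν i : Measure ℝ) (m' : Measure ℝ) (u (i, n))

/-- Change of measure for an event that only depends on the first `N` rewards of arm `i` and on the
rewards of the other arms. -/
lemma tableLaw_real_le_exp_mul_add (i : Fin K) {m' : ProbabilityMeasure ℝ}
    (hac : (ν i : Measure ℝ) ≪ m') {N : ℕ} {E : Set (RewardTable K)} (hE : MeasurableSet E)
    (hdep : DependsOnCoords E (Policy.observable K T i N)) (a : ℝ) :
    (tableLaw ν).real E ≤ Real.exp a * (tableLaw (Function.update ν i m')).real E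
      + (tableLaw ν).real {u | a < tableLlr ν i m' N u} := by
  classical
  -- A hybrid law: `m'` governs only the first `N` rewards of arm `i`. It differs from `ν` in
  -- finitely many factors, so a product density exists, and it agrees with the modified bandit on
  -- all coordinates that `E` sees.
  let lam : Fin K × ℕ → Measure ℝ := fun q =>
    ((if q.1 = i ∧ q.2 < N then m' else ν q.1 : ProbabilityMeasure ℝ) : Measure ℝ)
  let S : Finset (Fin K × ℕ) := {i} ×ˢ Finset.range N
  let f : ℝ → ℝ≥0∞ := (ν i : Measure ℝ).rnDeriv m'
  have hf : Measurable f := Measure.measurable_rnDeriv _ _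
  have hP : tableLaw ν
      = (Measure.infinitePi lam).withDensity fun u => ∏ q ∈ S, f (u q) := by
    refine infinitePi_eq_withDensity (f := fun _ => f) (fun _ => hf) S (fun q hq => ?_)
      (fun q hq => ?_)
    · obtain ⟨h1, h2⟩ : q.1 = i ∧ q.2 < N := by
        simpa only [S, Finset.mem_product, Finset.mem_singleton, Finset.mem_range] using hq
      simp only [lam, h1, h2, and_self, if_true]
      exact (Measure.withDensity_rnDeriv_eq _ _ hac).symm
    · have : ¬ (q.1 = i ∧ q.2 < N) := by
        simpa only [S, Finset.mem_product, Finset.mem_singleton, Finset.mem_range] using hq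
      simp only [lam, this, if_false]
  have hQ : tableLaw (Function.update ν i m') E = Measure.infinitePi lam E := by
    refine infinitePi_congr_of_dependsOnCoords hE hdep fun q hq => ?_
    have hq' : q.1 = i → q.2 < N := (Finset.mem_filter.1 hq).2
    by_cases h : q.1 = i
    · simp [lam, h, hq' h]
    · simp [lam, h]
  have hprod : Measurable fun u : RewardTable K => ∏ q ∈ S, f (u q) :=
    Finset.measurable_prod _ fun q _ => hf.comp (measurable_pi_apply q)
  have hle : MeasurableSet {u : RewardTable K | ∏ q ∈ S, f (u q) ≤ ENNReal.ofReal (Real.exp a)} :=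
    measurableSet_le hprod measurable_const
  have h1 : tableLaw ν (E ∩ {u | ∏ q ∈ S, f (u q) ≤ ENNReal.ofReal (Real.exp a)})
      ≤ ENNReal.ofReal (Real.exp a) * tableLaw (Function.update ν i m') E := by
    rw [hQ, hP, withDensity_apply _ (hE.inter hle)]
    calc _ ≤ ∫⁻ _ in E ∩ {u | ∏ q ∈ S, f (u q) ≤ ENNReal.ofReal (Real.exp a)},
          ENNReal.ofReal (Real.exp a) ∂(Measure.infinitePi lam) :=
          setLIntegral_mono measurable_const fun u hu => hu.2
      _ = ENNReal.ofReal (Real.exp a) * Measure.infinitePi lam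
          (E ∩ {u | ∏ q ∈ S, f (u q) ≤ ENNReal.ofReal (Real.exp a)}) := setLIntegral_const _ _
      _ ≤ _ := by gcongr; exact Set.inter_subset_left
  -- Positivity and finiteness of the density under `ν i` are what turn the log of the product into
  -- the sum of the logs.
  have hpos : ∀ᵐ x ∂(ν i : Measure ℝ), 0 < f x ∧ f x < ∞ :=
    (Measure.rnDeriv_pos hac).and (hac.ae_le (Measure.rnDeriv_lt_top _ _))
  have hposu : ∀ᵐ u ∂(tableLaw ν), ∀ n, 0 < f (u (i, n)) ∧ f (u (i, n)) < ∞ :=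
    ae_all_iff.2 fun n =>
      (measurePreserving_eval_tableLaw ν (i, n)).quasiMeasurePreserving.ae hpos
  have h2 : tableLaw ν {u | ∏ q ∈ S, f (u q) ≤ ENNReal.ofReal (Real.exp a)}ᶜ
      ≤ tableLaw ν {u | a < tableLlr ν i m' N u} := by
    refine measure_mono_ae (hposu.mono fun u hu hgt => ?_)
    have hgt : ENNReal.ofReal (Real.exp a) < ∏ q ∈ S, f (u q) := not_le.1 hgt
    have e : ∏ q ∈ S, f (u q) = ∏ n ∈ Finset.range N, f (u (i, n)) := by
      rw [Finset.prod_product, Finset.prod_singleton]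
    have hlog : Real.log (∏ q ∈ S, f (u q)).toReal = tableLlr ν i m' N u := by
      rw [e, ENNReal.toReal_prod, Real.log_prod fun n _ =>
        (ENNReal.toReal_pos (hu n).1.ne' (hu n).2.ne).ne']
      rfl
    change a < tableLlr ν i m' N u
    have hfin : ∏ q ∈ S, f (u q) ≠ ∞ := by
      rw [e]
      exact ENNReal.prod_ne_top fun n _ => (hu n).2.ne
    rw [← hlog, Real.lt_log_iff_exp_lt]
    · exact (ENNReal.ofReal_lt_iff_lt_toReal (Real.exp_pos a).le hfin).1 hgt
    · exact ENNReal.toReal_pos (ne_bot_of_gt hgt) hfin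
  have h3 : tableLaw ν E ≤ ENNReal.ofReal (Real.exp a) * tableLaw (Function.update ν i m') E
      + tableLaw ν {u | a < tableLlr ν i m' N u} :=
    calc tableLaw ν E = tableLaw ν (E ∩ {u | ∏ q ∈ S, f (u q) ≤ ENNReal.ofReal (Real.exp a)})
          + tableLaw ν (E \ {u | ∏ q ∈ S, f (u q) ≤ ENNReal.ofReal (Real.exp a)}) :=
          (measure_inter_add_sdiff E hle).symm
      _ ≤ _ := add_le_add h1 ((measure_mono fun u hu => hu.2).trans h2)
  have h4 := ENNReal.toReal_mono (by finiteness) h3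
  rw [ENNReal.toReal_add (by finiteness) (by finiteness), ENNReal.toReal_mul,
    ENNReal.toReal_ofReal (Real.exp_pos a).le] at h4
  exact h4

/-- The weak law of large numbers for log-likelihood ratios. -/
lemma tendsto_measure_tableLlr_gt (i : Fin K) {m' : ProbabilityMeasure ℝ}
    (hd : InformationTheory.klDiv (ν i : Measure ℝ) m' ≠ ∞) {c : ℝ}
    (hc : (InformationTheory.klDiv (ν i : Measure ℝ) m').toReal < c) :
    Tendsto (fun N : ℕ => (tableLaw ν).real {u | c * N < tableLlr ν i m' N u}) atTop (𝓝 0) := by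
  obtain ⟨hac, hint⟩ := InformationTheory.klDiv_ne_top_iff.1 hd
  have hllr : ∫ x, llr (ν i : Measure ℝ) m' x ∂(ν i : Measure ℝ) < c := by
    -- Both measures have mass one, so the mass correction in `klDiv` vanishes.
    refine lt_of_le_of_lt ?_ hc
    rw [InformationTheory.klDiv_of_ac_of_integrable hac hint]
    simp only [probReal_univ, add_sub_cancel_right]
    exact Real.le_coe_toNNReal _
  have hmp := fun n => measurePreserving_eval_tableLaw ν (i, n)
  let X : ℕ → RewardTable K → ℝ := fun n u => llr (ν i : Measure ℝ) (m' : Measure ℝ) (u (i, n))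
  have hX : ∀ n, Measurable (X n) := fun n =>
    (measurable_llr _ _).comp (measurable_pi_apply _)
  have hmap : ∀ n, (tableLaw ν).map (X n)
      = (ν i : Measure ℝ).map (llr (ν i : Measure ℝ) (m' : Measure ℝ)) := fun n =>
    (Measure.map_map (measurable_llr _ _) (measurable_pi_apply (i, n))).symm.trans
      (congrArg _ (hmp n).map_eq)
  have hinj : Function.Injective fun n : ℕ => (i, n) := fun a b h => (Prod.mk.inj h).2
  have hind : ProbabilityTheory.iIndepFun X (tableLaw ν) :=
    (ProbabilityTheory.iIndepFun_infinitePi (P := fun q : Fin K × ℕ => (ν q.1 : Measure ℝ))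
      (X := fun _ => llr (ν i : Measure ℝ) (m' : Measure ℝ))
      (fun _ => measurable_llr _ _)).precomp hinj
  have hXint : Integrable (X 0) (tableLaw ν) := (hmp 0).integrable_comp_of_integrable hint
  have hmean : ∫ u, X 0 u ∂(tableLaw ν)
      = ∫ x, llr (ν i : Measure ℝ) m' x ∂(ν i : Measure ℝ) :=
    (integral_map (measurable_pi_apply (i, 0)).aemeasurable
      (measurable_llr _ _).aestronglyMeasurable).symm.trans (by rw [(hmp 0).map_eq])
  have hslln := ProbabilityTheory.strong_law_ae_real X hXint
    (fun _ _ hne => hind.indepFun hne)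
    (fun n => ⟨(hX n).aemeasurable, (hX 0).aemeasurable, by rw [hmap, hmap]⟩)
  rw [hmean] at hslln
  have hmeas := tendstoInMeasure_of_tendsto_ae (fun N : ℕ =>
    ((Finset.measurable_sum (Finset.range N) fun n _ => hX n).div_const
      (N : ℝ)).aestronglyMeasurable) hslln
  set d := ∫ x, llr (ν i : Measure ℝ) m' x ∂(ν i : Measure ℝ)
  -- Exceeding `c N` forces the average to be at least `c - d` away from its limit `d`.
  have h1 := (tendstoInMeasure_iff_measureReal_dist.1 hmeas) (c - d) (by linarith)
  refine squeeze_zero' (.of_forall fun _ => measureReal_nonneg) ?_ h1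
  filter_upwards [eventually_ge_atTop 1] with N hN
  refine measureReal_mono fun u hu => ?_
  have hN' : (0 : ℝ) < N := by exact_mod_cast hN
  have hu' : c * N < ∑ n ∈ Finset.range N, X n u := hu
  have h2 : c < (∑ n ∈ Finset.range N, X n u) / N := (lt_div_iff₀ hN').2 hu'
  change c - d ≤ dist _ d
  rw [Real.dist_eq]
  exact le_trans (by linarith) (le_abs_self _)

lemma tendsto_floor_mul_log_div (y : ℝ) (hy : 0 ≤ y) :
    Tendsto (fun T : ℕ => (⌊y * Real.log T⌋₊ : ℝ) / T) atTop (𝓝 0) := by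
  have h : Tendsto (fun T : ℕ => y * (Real.log T / T)) atTop (𝓝 0) := by
    simpa using ((Real.isLittleO_log_id_atTop.tendsto_div_nhds_zero).comp
      tendsto_natCast_atTop_atTop).const_mul y
  refine squeeze_zero' (.of_forall fun T => by positivity) (.of_forall fun T => ?_) h
  rw [← mul_div_assoc]
  gcongr
  exact Nat.floor_le (mul_nonneg hy (Real.log_natCast_nonneg T))

/-! ### Logarithmic lower bounds on pulls and on regret. -/

/-- A consistent sequence of policies pulls a suboptimal arm logarithmically often, with
probability tending to `1`. -/
theorem Consistent.tendsto_measure_count_le {π : (T : ℕ) → Policy K T}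
    (hπ : Consistent π (unitBandits K)) (hν : ν ∈ unitBandits K) {k : Fin K}
    (hk : IsUniqueOptimalArm ν k) (i : Fin K) {m' : ProbabilityMeasure ℝ}
    (hm' : m' ∈ unitDistributions) (hmean : mean (ν k) < mean m')
    (hd : InformationTheory.klDiv (ν i : Measure ℝ) m' ≠ ∞) {y : ℝ} (hy : 0 < y)
    (hyd : y * (InformationTheory.klDiv (ν i : Measure ℝ) m').toReal < 1) :
    Tendsto (fun T : ℕ => (tableLaw ν).real {u | (π T).count u i ≤ ⌊y * Real.log T⌋₊})
      atTop (𝓝 0) := by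
  have hac := (InformationTheory.klDiv_ne_top_iff.1 hd).1
  -- The likelihood threshold is `ρ log T`: `ρ > y D` makes exceeding it unlikely under `ν`, and `ρ
  -- < 1` keeps the factor `T^ρ` below the power gained from consistency.
  obtain ⟨ρ, hρ1, hρ2⟩ := exists_between hyd
  have hQ : Function.update ν i m' ∈ unitBandits K := fun j => by
    by_cases h : j = i
    · subst h; simpa using hm'
    · simpa [h] using hν j
  have hQopt : IsUniqueOptimalArm (Function.update ν i m') i := fun j hj => by
    rw [Function.update_self, Function.update_of_ne hj]
    by_cases h : j = k
    · rwa [h]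
    · exact (hk j h).trans hmean
  have hpos : 0 < mean (Function.update ν i m' i) := by
    rw [Function.update_self]
    exact (mean_mem_Icc (hν k)).1.trans_lt hmean
  -- With this `p`, the product `T^ρ * T^(p-1)` equals `T^(-p)`.
  have hp : 0 < (1 - ρ) / 2 := by linarith
  obtain ⟨C, hC⟩ := hπ.eventually_measure_failureEvent_le hQ hQopt hpos
    (tendsto_floor_mul_log_div y hy.le) hp
  have hfloor : Tendsto (fun T : ℕ => ⌊y * Real.log T⌋₊) atTop atTop :=
    tendsto_nat_floor_atTop.comp ((Real.tendsto_log_atTop.comp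
      tendsto_natCast_atTop_atTop).const_mul_atTop hy)
  have hllr := (tendsto_measure_tableLlr_gt (ν := ν) i hd (c := ρ / y)
    ((lt_div_iff₀ hy).2 (by linarith))).comp hfloor
  have hpow : Tendsto (fun T : ℕ => C * (T : ℝ) ^ (-((1 - ρ) / 2))) atTop (𝓝 0) := by
    simpa using ((tendsto_rpow_neg_atTop hp).comp tendsto_natCast_atTop_atTop).const_mul C
  refine squeeze_zero' (.of_forall fun _ => measureReal_nonneg) ?_
    (by simpa using hpow.add hllr)
  filter_upwards [hC, eventually_ge_atTop 1] with T hC hT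
  have hT0 : (0 : ℝ) < T := by exact_mod_cast hT
  set N := ⌊y * Real.log T⌋₊
  have h := tableLaw_real_le_exp_mul_add i hac ((π T).measurableSet_count_le i N)
    ((π T).dependsOnCoords_count_le i N) (ρ * Real.log T)
  refine h.trans (add_le_add ?_ (measureReal_mono fun u hu => ?_))
  · have hsub : (tableLaw (Function.update ν i m')).real {u | (π T).count u i ≤ N}
        ≤ C * (T : ℝ) ^ ((1 - ρ) / 2 - 1) :=
      (measureReal_mono Set.subset_union_right).trans hC
    have e : Real.exp (ρ * Real.log T) = (T : ℝ) ^ ρ := by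
      rw [Real.rpow_def_of_pos hT0, mul_comm]
    have e2 : (T : ℝ) ^ (-((1 - ρ) / 2)) = (T : ℝ) ^ ρ * (T : ℝ) ^ ((1 - ρ) / 2 - 1) := by
      rw [← Real.rpow_add hT0]
      congr 1
      ring
    rw [e, e2, mul_left_comm]
    gcongr
  · have hN : (N : ℝ) ≤ y * Real.log T :=
      Nat.floor_le (mul_nonneg hy.le (Real.log_natCast_nonneg T))
    have hρ : 0 < ρ := lt_of_le_of_lt (by positivity) hρ1
    have h1 : ρ / y * N ≤ ρ * Real.log T := by
      rw [div_mul_eq_mul_div, div_le_iff₀ hy]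
      calc ρ * N ≤ ρ * (y * Real.log T) := by gcongr
        _ = _ := by ring
    exact h1.trans_lt hu

/-- If `k` does not fail, `T - n_k` is the sum of the other counts, and each is at least `y i * log
T` outside its rare-pull event. The indicators of the two bad events are subtracted, so on failure
every summand is nonpositive. -/
lemma Policy.sum_le_integral_sub_count (π : Policy K T) (k : Fin K) {y : Fin K → ℝ}
    (hy : ∀ i, 0 ≤ y i) :
    ∑ i ∈ Finset.univ.erase k, y i * Real.log T * (1
        - (tableLaw ν).real {u | π.count u i ≤ ⌊y i * Real.log T⌋₊}
        - (tableLaw ν).real (π.failureEvent k 0))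
      ≤ ∫ u, (π.failureEvent k 0)ᶜ.indicator (fun u => (T - π.count u k : ℝ)) u
          ∂(tableLaw ν) := by
  have hA := π.measurableSet_failureEvent k 0
  have hB := fun i => π.measurableSet_count_le i ⌊y i * Real.log T⌋₊
  have hlog : 0 ≤ Real.log T := Real.log_natCast_nonneg T
  have iA : Integrable ((π.failureEvent k 0).indicator (1 : RewardTable K → ℝ)) (tableLaw ν) :=
    (integrable_const (1 : ℝ)).indicator hA
  have iB : ∀ i, Integrable ({u | π.count u i ≤ ⌊y i * Real.log T⌋₊}.indicator
      (1 : RewardTable K → ℝ)) (tableLaw ν) := fun i =>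
    (integrable_const (1 : ℝ)).indicator (hB i)
  have iC : ∀ i, Integrable (fun u : RewardTable K => (1 : ℝ)
      - {u | π.count u i ≤ ⌊y i * Real.log T⌋₊}.indicator 1 u
      - (π.failureEvent k 0).indicator 1 u) (tableLaw ν) := fun i =>
    ((integrable_const (1 : ℝ)).sub (iB i)).sub iA
  have hint : ∑ i ∈ Finset.univ.erase k, y i * Real.log T * (1
        - (tableLaw ν).real {u | π.count u i ≤ ⌊y i * Real.log T⌋₊}
        - (tableLaw ν).real (π.failureEvent k 0))
      = ∫ u, ∑ i ∈ Finset.univ.erase k, y i * Real.log T * ((1 : ℝ)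
        - {u | π.count u i ≤ ⌊y i * Real.log T⌋₊}.indicator 1 u
        - (π.failureEvent k 0).indicator 1 u) ∂(tableLaw ν) := by
    rw [integral_finsetSum _ fun i _ => (iC i).const_mul _]
    refine Finset.sum_congr rfl fun i _ => ?_
    have i1 := integral_sub ((integrable_const (μ := tableLaw ν) (1 : ℝ)).sub (iB i)) iA
    have i2 := integral_sub (integrable_const (μ := tableLaw ν) (1 : ℝ)) (iB i)
    simp only [Pi.sub_apply] at i1 i2
    rw [integral_const_mul, i1, i2, integral_indicator_one (hB i), integral_indicator_one hA]
    simp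
  rw [hint]
  refine integral_mono (integrable_finsetSum _ fun i _ => (iC i).const_mul _)
    (((integrable_const (T : ℝ)).sub (π.integrable_count k)).indicator hA.compl) fun u => ?_
  by_cases hu : u ∈ π.failureEvent k 0
  · rw [Set.indicator_of_notMem (Set.notMem_compl_iff.2 hu)]
    refine Finset.sum_nonpos fun i _ =>
      mul_nonpos_of_nonneg_of_nonpos (mul_nonneg (hy i) hlog) ?_
    have h0 : (0 : ℝ) ≤ {u | π.count u i ≤ ⌊y i * Real.log T⌋₊}.indicator
        (1 : RewardTable K → ℝ) u := Set.indicator_nonneg (fun _ _ => zero_le_one) _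
    rw [Set.indicator_of_mem hu, Pi.one_apply]
    linarith
  · rw [Set.indicator_of_mem (Set.mem_compl hu)]
    have hsum : ∑ i ∈ Finset.univ.erase k, (π.count u i : ℝ) = T - π.count u k := by
      rw [Finset.sum_erase_eq_sub (Finset.mem_univ k), ← Nat.cast_sum, π.sum_count]
    rw [← hsum]
    refine Finset.sum_le_sum fun i _ => ?_
    rw [Set.indicator_of_notMem hu]
    by_cases hi : π.count u i ≤ ⌊y i * Real.log T⌋₊
    · simp [hi]
    · have h1 := Nat.lt_of_floor_lt (not_le.1 hi)
      simpa [hi] using h1.le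

/-- The regret of a consistent sequence of policies in terms of rates `y i` such that each
suboptimal arm `i` is pulled more than `y i * log T` times with probability tending to `1`. -/
lemma Consistent.exists_tendsto_le_regret_div_log {π : (T : ℕ) → Policy K T}
    (hπ : Consistent π (unitBandits K)) (hν : ν ∈ unitBandits K) {k : Fin K}
    (hk : IsUniqueOptimalArm ν k) (hpos : 0 < mean (ν k)) {y : Fin K → ℝ} (hy : ∀ i, 0 ≤ y i)
    (hcount : ∀ i, 0 < y i → Tendsto (fun T : ℕ => (tableLaw ν).real
      {u | (π T).count u i ≤ ⌊y i * Real.log T⌋₊}) atTop (𝓝 0)) :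
    ∃ L : ℕ → ℝ, Tendsto L atTop (𝓝 (∑ i ∈ Finset.univ.erase k, mean (ν k) * y i)) ∧
      ∀ᶠ T : ℕ in atTop, L T ≤ (π T).regret ν / Real.log T := by
  obtain ⟨δ, hδ, hgap, hδμ⟩ := hk.exists_gap hpos
  refine ⟨fun T => ∑ i ∈ Finset.univ.erase k, mean (ν k) * (y i * (1
      - (tableLaw ν).real {u | (π T).count u i ≤ ⌊y i * Real.log T⌋₊}
      - (tableLaw ν).real ((π T).failureEvent k 0)))
      - 3 * (T * (tableLaw ν).real (deviationEvent ν (δ / 8) T)), ?_, ?_⟩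
  · have hfail : Tendsto (fun T => (tableLaw ν).real ((π T).failureEvent k 0)) atTop (𝓝 0) := by
      -- Any exponent `p < 1` would do here.
      obtain ⟨C, hC⟩ := hπ.eventually_measure_failureEvent_le hν hk hpos (N := fun _ => 0)
        (by simp) (p := 1 / 2) (by norm_num)
      refine squeeze_zero' (.of_forall fun _ => measureReal_nonneg) hC ?_
      have h := ((tendsto_rpow_neg_atTop (y := 1 / 2) (by norm_num)).comp
        tendsto_natCast_atTop_atTop).const_mul C
      rw [mul_zero] at h
      convert! h using 3
      norm_num
    have hdev := (tendsto_mul_measure_deviationEvent hν (δ := δ / 8) (by positivity)).const_mul 3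
    have hterm : ∀ i, Tendsto (fun T : ℕ => mean (ν k) * (y i * (1
        - (tableLaw ν).real {u | (π T).count u i ≤ ⌊y i * Real.log T⌋₊}
        - (tableLaw ν).real ((π T).failureEvent k 0)))) atTop (𝓝 (mean (ν k) * y i)) := by
      intro i
      rcases (hy i).eq_or_lt with h0 | h0
      · simp [← h0]
      · simpa using ((((hcount i h0).const_sub 1).sub hfail).const_mul (y i)).const_mul
          (mean (ν k))
    simpa using (tendsto_finsetSum (Finset.univ.erase k) fun i _ => hterm i).sub hdev
  -- From `T = 3` on, `log T ≥ 1`, so the deviation term need not be divided by `log T`.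
  · filter_upwards [eventually_ge_atTop 3] with T hT
    have hlog : 1 ≤ Real.log T := by
      rw [Real.le_log_iff_exp_le (by positivity)]
      have : (3 : ℝ) ≤ T := by exact_mod_cast hT
      linarith [Real.exp_one_lt_d9]
    have h1 := (π T).loss_le_regret hν hδ hgap hδμ (N := 0) (by simp; positivity)
    have h2 := mul_le_mul_of_nonneg_left
      ((π T).sum_le_integral_sub_count (ν := ν) k hy) hpos.le
    have h3 : 0 ≤ δ / 2 * T * (tableLaw ν).real ((π T).failureEvent k 0) := by positivity
    have h4 : 0 ≤ T * (tableLaw ν).real (deviationEvent ν (δ / 8) T) := by positivity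
    rw [le_div_iff₀ (by linarith), sub_mul, Finset.sum_mul]
    rw [Finset.mul_sum] at h2
    have h5 := mul_le_mul_of_nonneg_left hlog h4
    have e : ∑ i ∈ Finset.univ.erase k, mean (ν k) * (y i * (1
        - (tableLaw ν).real {u | (π T).count u i ≤ ⌊y i * Real.log T⌋₊}
        - (tableLaw ν).real ((π T).failureEvent k 0))) * Real.log T
        = ∑ i ∈ Finset.univ.erase k, mean (ν k) * (y i * Real.log T * (1
        - (tableLaw ν).real {u | (π T).count u i ≤ ⌊y i * Real.log T⌋₊}
        - (tableLaw ν).real ((π T).failureEvent k 0))) :=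
      Finset.sum_congr rfl fun i _ => by ring
    rw [e]
    linarith

/-! ### Passage to extended reals and conclusion. -/

/-- A finite sum of extended nonnegative reals is bounded by any bound of the sums of smaller
reals. -/
lemma _root_.ENNReal.sum_le_of_forall_lt {ι : Type*} (s : Finset ι) (t : ι → ℝ≥0∞) {b : EReal}
    (h : ∀ x : ι → NNReal, (∀ i, x i = 0 ∨ (x i : ℝ≥0∞) < t i) →
      ((∑ i ∈ s, (x i : ℝ) : ℝ) : EReal) ≤ b) : ((∑ i ∈ s, t i : ℝ≥0∞) : EReal) ≤ b := by
  have hseq : ∀ i, ∃ x : ℕ → NNReal, (∀ n, x n = 0 ∨ (x n : ℝ≥0∞) < t i) ∧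
      Tendsto (fun n => (x n : ℝ≥0∞)) atTop (𝓝 (t i)) := fun i => by
    -- Nothing lies strictly below a zero term, hence the alternative `x i = 0`; infinite terms are
    -- approximated like finite ones.
    rcases eq_or_ne (t i) 0 with h0 | h0
    · exact ⟨fun _ => 0, fun _ => Or.inl rfl, by simp [h0]⟩
    · obtain ⟨z, -, hz, hlim⟩ := exists_seq_strictMono_tendsto' (pos_iff_ne_zero.2 h0)
      have hcoe : ∀ n, ((z n).toNNReal : ℝ≥0∞) = z n := fun n =>
        ENNReal.coe_toNNReal (ne_top_of_lt (hz n).2)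
      exact ⟨fun n => (z n).toNNReal, fun n => Or.inr ((hcoe n).trans_lt (hz n).2),
        by simpa only [hcoe] using hlim⟩
  choose x hx hlim using hseq
  have hsum : Tendsto (fun n => ((∑ i ∈ s, (x i n : ℝ≥0∞) : ℝ≥0∞) : EReal)) atTop
      (𝓝 ((∑ i ∈ s, t i : ℝ≥0∞) : EReal)) :=
    (continuous_coe_ennreal_ereal.tendsto _).comp (tendsto_finsetSum s fun i _ => hlim i)
  refine le_of_tendsto' hsum fun n => ?_
  refine le_of_eq_of_le ?_ (h (fun i => x i n) fun i => hx i n)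
  rw [← ENNReal.ofNNReal_finsetSum, EReal.coe_nnreal_eq_coe_real, NNReal.coe_sum]

/-- Inverting the quotient gives `d_inf < μ / x`, and an infimum below a bound has a competitor
below it. -/
lemma exists_klDiv_lt_of_lt_div_dInf {m : ProbabilityMeasure ℝ} {μ : ℝ} {x : NNReal}
    (h : (x : ℝ≥0∞) < ENNReal.ofReal μ / dInf m μ unitDistributions) (hx : 0 < x) :
    ∃ m' ∈ unitDistributions, μ < mean m' ∧ InformationTheory.klDiv (m : Measure ℝ) m' ≠ ∞ ∧
      x * (InformationTheory.klDiv (m : Measure ℝ) m').toReal < μ := by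
  have hx' : (x : ℝ≥0∞) ≠ 0 := by exact_mod_cast hx.ne'
  have hd : dInf m μ unitDistributions < ENNReal.ofReal μ / x := by
    by_contra! hcon
    refine absurd h (not_lt.2 (ENNReal.div_le_of_le_mul ?_))
    calc ENNReal.ofReal μ = x * (ENNReal.ofReal μ / x) :=
          (ENNReal.mul_div_cancel hx' ENNReal.coe_ne_top).symm
      _ ≤ _ := by gcongr
  simp only [dInf, iInf_lt_iff] at hd
  obtain ⟨m', hm', hmean, hlt⟩ := hd
  refine ⟨m', hm', hmean, ne_top_of_lt hlt, ?_⟩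
  have h1 : x * InformationTheory.klDiv (m : Measure ℝ) m' < ENNReal.ofReal μ := by
    rw [mul_comm]
    exact (ENNReal.lt_div_iff_mul_lt (Or.inl hx') (Or.inl ENNReal.coe_ne_top)).1 hlt
  have h2 := (ENNReal.lt_ofReal_iff_toReal_lt (ne_top_of_lt h1)).1 h1
  simpa using h2

end MaxBandit

theorem theorem1 (K : ℕ) (π : (T : ℕ) → MaxBandit.Policy K T)
    (hπ : MaxBandit.Consistent π (MaxBandit.unitBandits K))
    (ν : Fin K → ProbabilityMeasure ℝ) (hν : ν ∈ MaxBandit.unitBandits K)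
    (k : Fin K) (hk : MaxBandit.IsUniqueOptimalArm ν k) :
    ((∑ i ∈ Finset.univ.erase k,
        ENNReal.ofReal (MaxBandit.mean (ν k)) /
          MaxBandit.dInf (ν i) (MaxBandit.mean (ν k)) MaxBandit.unitDistributions : ℝ≥0∞) : EReal)
      ≤ liminf (fun T : ℕ => (((π T).regret ν / Real.log T : ℝ) : EReal)) atTop := by
  -- For `μ* = 0` the left side is zero, and nonnegativity of the regret suffices.
  rcases (MaxBandit.mean_mem_Icc (hν k)).1.eq_or_lt with h0 | hpos
  · rw [← h0]
    simp only [ENNReal.ofReal_zero, ENNReal.zero_div, Finset.sum_const_zero, EReal.coe_ennreal_zero]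
    refine le_liminf_of_le (by isBoundedDefault) (.of_forall fun T => ?_)
    exact_mod_cast div_nonneg ((π T).regret_nonneg hν) (Real.log_natCast_nonneg T)
  refine ENNReal.sum_le_of_forall_lt _ _ fun x hx => ?_
  -- The rate is `x i / μ*` because each pull costs `μ*`; arms without a competitor get rate zero.
  obtain ⟨L, hL, hle⟩ := hπ.exists_tendsto_le_regret_div_log hν hk hpos
    (y := fun i => x i / MaxBandit.mean (ν k)) (fun i => by positivity) fun i hi => by
      have hxi : 0 < x i := by
        have := (div_pos_iff_of_pos_right hpos).1 hi
        exact_mod_cast this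
      obtain ⟨m', hm', hmean, hd, hlt⟩ :=
        MaxBandit.exists_klDiv_lt_of_lt_div_dInf ((hx i).resolve_left hxi.ne') hxi
      refine hπ.tendsto_measure_count_le hν hk i hm' hmean hd hi ?_
      rwa [div_mul_eq_mul_div, div_lt_one hpos]
  have hsum : ∑ i ∈ Finset.univ.erase k, MaxBandit.mean (ν k) * (x i / MaxBandit.mean (ν k))
      = ∑ i ∈ Finset.univ.erase k, (x i : ℝ) :=
    Finset.sum_congr rfl fun i _ => mul_div_cancel₀ _ hpos.ne'
  rw [hsum] at hL
  have hL' := (continuous_coe_real_ereal.tendsto _).comp hL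
  rw [← hL'.liminf_eq]
  exact liminf_le_liminf (hle.mono fun T hT => EReal.coe_le_coe_iff.2 hT)
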